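/- Let $(\Omega,\mathcal F,P)$ be a probability space, let $L^\infty$ be the algebra of $P$-a.s. equivalence classes of essentially bounded real random variables with the almost sure order, and let $\tilde I_A\in L^\infty$ denote the class of the indicator function of $A\in\mathcal F$. An $L^\infty$-normed module is an $L^\infty$-module $E$ with a map $\|\cdot\|:E\to L^\infty_+$ such that $\|x\|=0$ iff $x=0$, $\|\xi x\|=|\xi|\,\|x\|$ and $\|x+y\|\le\|x\|+\|y\|$ for all $x,y\in E$ and $\xi\in L^\infty$; it carries the topology of the real norm $\|x\|_\infty=\operatorname{ess\,sup}\|x\|$ and is called complete if $(E,\|\cdot\|_\infty)$ is complete. Let $U(E)=\{x\in E:\|x\|\le1\}$. The set $U(E)$ has the countable concatenation property if for every sequence $(g_n)$ in $U(E)$ and every countable partition $(A_n)$ of $\Omega$ into members of $\mathcal F$ there is $g\in U(E)$ with $\tilde I_{A_n}g=\tilde I_{A_n}g_n$ for all $n$. Let $E'$ be the $L^\infty$-module of all continuous $L^\infty$-module homomorphisms $f:E\to L^\infty$, with $\|f\|'=\bigvee\{|f(x)|:x\in U(E)\}\in L^\infty_+$ (supremum in the almost sure order). **Theorem.** Let $E$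 be a complete $L^\infty$-normed module such that $U(E)$ has the countable concatenation property. Then $E$ is subreflexive: the set $$A(E)=\{f\in E' : \text{there is } x\in U(E)\text{ with } |f(x)|=\|f\|'\}$$ is dense in $E'$, that is, for every $f\in E'$ and every $\varepsilon>0$ there is $g\in A(E)$ with $\operatorname{ess\,sup}\|f-g\|'<\varepsilon$. -/

import Mathlib

open MeasureTheory Set Filter
open scoped ENNReal Topology

noncomputable section

variable {Ω : Type*} [MeasurableSpace Ω]

/-- The space `L^∞` of classes of essentially bounded real random variables, with the norm
`‖ξ‖ = ess sup |ξ|` and the almost sure order. -/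
abbrev LInfty (P : Measure Ω) : Type _ := Lp ℝ ∞ P

namespace LInfty

variable {P : Measure Ω}

/-- The product of classes is the class of the pointwise product. -/
instance instMul : Mul (LInfty P) where
  mul f g := ⟨f.1 * g.1, by
    rw [Lp.mem_Lp_iff_memLp]
    exact (memLp_congr_ae (AEEqFun.coeFn_mul f.1 g.1)).mpr
      ((Lp.memLp g).mul' (Lp.memLp f))⟩

/-- The class of the constant function `1`. -/
instance instOne : One (LInfty P) where
  one := ⟨AEEqFun.const Ω 1, by
    rw [Lp.mem_Lp_iff_memLp]
    exact (memLp_congr_ae (AEEqFun.coeFn_const Ω 1)).mpr (memLp_top_const 1)⟩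

theorem coeFn_mul (f g : LInfty P) : ⇑(f * g) =ᵐ[P] fun ω => f ω * g ω :=
  AEEqFun.coeFn_mul f.1 g.1

theorem coeFn_one : ⇑(1 : LInfty P) =ᵐ[P] fun _ => 1 :=
  AEEqFun.coeFn_const Ω 1

theorem add_mul_aux (f g h : LInfty P) : (f + g) * h = f * h + g * h := by
  apply Lp.ext
  filter_upwards [coeFn_mul (f + g) h, Lp.coeFn_add f g, Lp.coeFn_add (f * h) (g * h),
    coeFn_mul f h, coeFn_mul g h] with ω h1 h2 h3 h4 h5
  simp only [h1, h2, h3, h4, h5, Pi.add_apply]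
  ring

theorem mul_comm_aux (f g : LInfty P) : f * g = g * f := by
  apply Lp.ext
  filter_upwards [coeFn_mul f g, coeFn_mul g f] with ω h1 h2
  rw [h1, h2, mul_comm]

theorem one_mul_aux (f : LInfty P) : 1 * f = f := by
  apply Lp.ext
  filter_upwards [coeFn_mul 1 f, coeFn_one (P := P)] with ω h1 h2
  rw [h1, h2, one_mul]

theorem mul_assoc_aux (f g h : LInfty P) : f * g * h = f * (g * h) := by
  apply Lp.ext
  filter_upwards [coeFn_mul (f * g) h, coeFn_mul f g, coeFn_mul f (g * h), coeFn_mul g h]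
    with ω h1 h2 h3 h4
  rw [h1, h2, h3, h4, mul_assoc]

theorem zero_mul_aux (f : LInfty P) : 0 * f = 0 := by
  apply Lp.ext
  filter_upwards [coeFn_mul 0 f, Lp.coeFn_zero ℝ ∞ P] with ω h1 h2
  rw [h1, h2, Pi.zero_apply, zero_mul]

/-- `L^∞` as a commutative ring; its additive structure is the one of the Banach space. -/
instance instCommRing : CommRing (LInfty P) where
  __ := (inferInstance : AddCommGroup (Lp ℝ ∞ P))
  mul_assoc := mul_assoc_aux
  mul_comm := mul_comm_aux
  one_mul := one_mul_aux
  mul_one f := by rw [mul_comm_aux, one_mul_aux]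
  zero_mul := zero_mul_aux
  mul_zero f := by rw [mul_comm_aux, zero_mul_aux]
  left_distrib f g h := by
    rw [mul_comm_aux, add_mul_aux, mul_comm_aux g, mul_comm_aux h]
  right_distrib := add_mul_aux

theorem smul_one_mul (r : ℝ) (f : LInfty P) : (r • (1 : LInfty P)) * f = r • f := by
  apply Lp.ext
  filter_upwards [coeFn_mul (r • (1 : LInfty P)) f, Lp.coeFn_smul r (1 : LInfty P),
    coeFn_one (P := P), Lp.coeFn_smul r f] with ω h1 h2 h3 h4
  simp [h1, h2, h3, h4]

theorem abs_le_norm_smul_one (f : LInfty P) : |f| ≤ ‖f‖ • (1 : LInfty P) := by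
  rw [← Lp.coeFn_le]
  filter_upwards [Lp.coeFn_abs f, Lp.coeFn_smul ‖f‖ (1 : LInfty P), coeFn_one (P := P),
    ae_le_eLpNormEssSup (f := f) (μ := P)] with ω h1 h2 h3 h4
  rw [h1, h2, Pi.smul_apply, h3, smul_eq_mul, mul_one, Lp.norm_def, eLpNorm_exponent_top,
    ← Real.norm_eq_abs, ← toReal_enorm]
  refine ENNReal.toReal_mono ?_ h4
  have := Lp.eLpNorm_ne_top f
  rwa [eLpNorm_exponent_top] at this

/-- The class `Ĩ_A` of the indicator function of a measurable set `A`. -/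
def ind [IsFiniteMeasure P] {A : Set Ω} (hA : MeasurableSet A) : LInfty P :=
  indicatorConstLp ∞ hA (measure_ne_top P A) (1 : ℝ)

/-- Every non-empty set in `L^∞` that is bounded above in the almost sure order has a least upper
bound. -/
theorem exists_isLUB [IsFiniteMeasure P] (S : Set (LInfty P)) (hne : S.Nonempty)
    (hbdd : BddAbove S) : ∃ t, IsLUB S t := by
  obtain ⟨b, hb⟩ := hbdd
  obtain ⟨s₀, hs₀⟩ := hne
  have hDb : ∀ d ∈ supClosure S, d ≤ b := by
    intro d hd
    have : b ∈ upperBounds (supClosure S) := by rwa [upperBounds_supClosure]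
    exact this hd
  have hint : ∀ f : LInfty P, Integrable f P := fun f => (Lp.memLp f).integrable le_top
  have hmono : ∀ f g : LInfty P, f ≤ g → ∫ ω, f ω ∂P ≤ ∫ ω, g ω ∂P := fun f g h =>
    integral_mono_ae (hint f) (hint g) ((Lp.coeFn_le f g).mpr h)
  set I : Set ℝ := (fun d : LInfty P => ∫ ω, d ω ∂P) '' supClosure S with hI
  have hIb : BddAbove I := ⟨∫ ω, b ω ∂P, by
    rintro _ ⟨d, hd, rfl⟩
    exact hmono _ _ (hDb d hd)⟩
  have hIne : I.Nonempty := ⟨_, s₀, subset_supClosure hs₀, rfl⟩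
  obtain ⟨u, -, hu, huI⟩ := exists_seq_tendsto_sSup hIne hIb
  choose d hd hdu using huI
  have hvD : ∀ n, partialSups d n ∈ supClosure S := by
    intro n
    induction n with
    | zero => simpa using hd 0
    | succ k ih =>
      rw [partialSups_add_one]
      exact supClosed_supClosure ih (hd _)
  set v : ℕ → LInfty P := fun n => partialSups d n with hv
  have hvmono : ∀ n, v n ≤ v (n + 1) := fun n => (partialSups d).monotone n.le_succ
  have hvI : Tendsto (fun n => ∫ ω, v n ω ∂P) atTop (𝓝 (sSup I)) := by
    refine tendsto_of_tendsto_of_tendsto_of_le_of_le hu tendsto_const_nhds ?_ ?_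
    · intro n
      simp only [← hdu]
      exact hmono _ _ (le_partialSups d n)
    · intro n
      exact le_csSup hIb ⟨_, hvD n, rfl⟩
  have hae : ∀ᵐ ω ∂P, (∀ n, v n ω ≤ v (n + 1) ω) ∧ ∀ n, v n ω ≤ b ω := by
    refine (ae_all_iff.mpr fun n => (Lp.coeFn_le _ _).mpr (hvmono n)).and
      (ae_all_iff.mpr fun n => (Lp.coeFn_le _ _).mpr (hDb _ (hvD n)))
  set t₀ : Ω → ℝ := fun ω => ⨆ n, v n ω with ht₀
  have hlub : ∀ᵐ ω ∂P, (∀ n, v n ω ≤ t₀ ω) ∧ (∀ c, (∀ n, v n ω ≤ c) → t₀ ω ≤ c) ∧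
      Tendsto (fun n => v n ω) atTop (𝓝 (t₀ ω)) := by
    filter_upwards [hae] with ω hω
    have hB : BddAbove (range fun n => v n ω) := ⟨b ω, by rintro _ ⟨n, rfl⟩; exact hω.2 n⟩
    exact ⟨fun n => le_ciSup hB n, fun c hc => ciSup_le hc,
      tendsto_atTop_ciSup (monotone_nat_of_le_succ hω.1) hB⟩
  have hmeas : AEStronglyMeasurable t₀ P :=
    aestronglyMeasurable_of_tendsto_ae atTop (fun n => (Lp.aestronglyMeasurable (v n)))
      (hlub.mono fun ω h => h.2.2)
  have hmem : MemLp t₀ ∞ P := by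
    refine ((Lp.memLp (v 0)).norm.add (Lp.memLp b).norm).mono hmeas ?_
    filter_upwards [hlub, hae] with ω h1 h2
    have h3 := h1.1 0
    have h4 := h1.2.1 _ h2.2
    simp only [Pi.add_apply, Real.norm_eq_abs]
    rw [abs_of_nonneg (a := |v 0 ω| + |b ω|) (by positivity)]
    refine abs_le.mpr ⟨?_, ?_⟩
    · linarith [neg_abs_le (v 0 ω), abs_nonneg (b ω)]
    · linarith [le_abs_self (b ω), abs_nonneg (v 0 ω)]
  refine ⟨hmem.toLp t₀, ?_, ?_⟩
  · intro s hs
    -- `∫ (t₀ ⊔ s) ≤ sSup I = ∫ t₀`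
    have h1 : Tendsto (fun n => ∫ ω, (v n ⊔ s : LInfty P) ω ∂P) atTop
        (𝓝 (∫ ω, (hmem.toLp t₀ ⊔ s : LInfty P) ω ∂P)) := by
      refine integral_tendsto_of_tendsto_of_monotone (fun n => hint _) (hint _) ?_ ?_
      · have h2 : ∀ n, (v n ⊔ s : LInfty P) ≤ v (n + 1) ⊔ s := fun n =>
          sup_le_sup_right (hvmono n) s
        filter_upwards [ae_all_iff.mpr fun n => (Lp.coeFn_le _ _).mpr (h2 n)] with ω h
        exact monotone_nat_of_le_succ h
      · filter_upwards [hlub, Lp.coeFn_sup (hmem.toLp t₀) s, hmem.coeFn_toLp,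
          ae_all_iff.mpr fun n => Lp.coeFn_sup (v n) s] with ω h2 h3 h4 h5
        simp only [h3, h5, Pi.sup_apply, h4]
        exact h2.2.2.sup_nhds tendsto_const_nhds
    have h2 : Tendsto (fun n => ∫ ω, v n ω ∂P) atTop (𝓝 (∫ ω, t₀ ω ∂P)) := by
      refine integral_tendsto_of_tendsto_of_monotone (fun n => hint _)
        (hmem.integrable le_top) ?_ (hlub.mono fun ω h => h.2.2)
      filter_upwards [hae] with ω h
      exact monotone_nat_of_le_succ h.1
    have h3 : ∫ ω, (hmem.toLp t₀ ⊔ s : LInfty P) ω ∂P ≤ ∫ ω, (hmem.toLp t₀) ω ∂P := by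
      rw [integral_congr_ae hmem.coeFn_toLp, tendsto_nhds_unique h2 hvI]
      refine le_of_tendsto' h1 fun n => le_csSup hIb ⟨_, ?_, rfl⟩
      exact supClosed_supClosure (hvD n) (subset_supClosure hs)
    have h4 : hmem.toLp t₀ ≤ hmem.toLp t₀ ⊔ s := le_sup_left
    have h5 : ∫ ω, (hmem.toLp t₀) ω ∂P = ∫ ω, (hmem.toLp t₀ ⊔ s : LInfty P) ω ∂P :=
      le_antisymm (hmono _ _ h4) h3
    have h6 : (hmem.toLp t₀ : Ω → ℝ) =ᵐ[P] (hmem.toLp t₀ ⊔ s : LInfty P) :=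
      (integral_eq_iff_of_ae_le (hint _) (hint _) ((Lp.coeFn_le _ _).mpr h4)).mp h5
    rw [Lp.ext h6]
    exact le_sup_right
  · intro c hc
    have hcD : c ∈ upperBounds (supClosure S) := by rwa [upperBounds_supClosure]
    rw [← Lp.coeFn_le]
    filter_upwards [hlub, hmem.coeFn_toLp,
      ae_all_iff.mpr fun n => (Lp.coeFn_le _ _).mpr (hcD (hvD n))] with ω h1 h2 h3
    rw [h2]
    exact h1.2.1 _ h3

end LInfty

/-- An `L^∞`-normed module `(E, ‖·‖)`: an `L^∞`-module with an `L^∞`-norm `lnorm : E → L^∞_+`.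
The real norm of `E`, which gives its topology, its uniformity and the meaning of completeness, is
`‖x‖_∞ = ess sup (lnorm x)`. -/
class LInftyNormedModule (P : Measure Ω) (E : Type*) [NormedAddCommGroup E]
    [Module (LInfty P) E] where
  /-- The `L^∞`-norm. -/
  lnorm : E → LInfty P
  lnorm_nonneg : ∀ x, 0 ≤ lnorm x
  lnorm_eq_zero_iff : ∀ x, lnorm x = 0 ↔ x = 0
  lnorm_smul : ∀ (ξ : LInfty P) (x : E), lnorm (ξ • x) = |ξ| * lnorm x
  lnorm_add_le : ∀ x y, lnorm (x + y) ≤ lnorm x + lnorm y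
  norm_eq : ∀ x, ‖x‖ = ‖lnorm x‖

namespace LInftyNormedModule

section CCP

variable (P : Measure Ω) [IsFiniteMeasure P] {E : Type*} [AddCommGroup E] [Module (LInfty P) E]

/-- The countable concatenation property of a subset `G` of an `L^∞`-module: for every sequence
`g n` in `G` and every countable measurable partition `A n` of `Ω` some `x ∈ G` satisfies
`Ĩ_{A n} x = Ĩ_{A n} g n` for all `n`. -/
def HasCountableConcatenation (G : Set E) : Prop :=
  ∀ (g : ℕ → E) (A : ℕ → Set Ω) (hA : ∀ n, MeasurableSet (A n)),
    (∀ n, g n ∈ G) → (⋃ n, A n) = univ → (∀ m n, m ≠ n → A m ∩ A n = ∅) →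
      ∃ x ∈ G, ∀ n, (LInfty.ind (hA n) : LInfty P) • x = (LInfty.ind (hA n) : LInfty P) • g n

/-- The property does not depend on whether `G` is regarded as a subset of `E` or of a module in
which `E` is embedded. -/
theorem hasCountableConcatenation_image_iff {S : Type*} [AddCommGroup S] [Module (LInfty P) S]
    (T : E →ₗ[LInfty P] S) (hT : Function.Injective T) (G : Set E) :
    HasCountableConcatenation P (T '' G) ↔ HasCountableConcatenation P G := by
  constructor
  · intro h g A hA hg hU hd
    obtain ⟨_, ⟨x, hx, rfl⟩, h⟩ := h (fun n => T (g n)) A hA (fun n => ⟨_, hg n, rfl⟩) hU hd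
    exact ⟨x, hx, fun n => hT (by simpa using h n)⟩
  · intro h g A hA hg hU hd
    choose g' hg' hgg using hg
    obtain ⟨x, hx, h⟩ := h g' A hA hg' hU hd
    refine ⟨T x, ⟨x, hx, rfl⟩, fun n => ?_⟩
    rw [← hgg, ← map_smul, h n, map_smul]

end CCP

variable (P : Measure Ω) (E : Type*) [NormedAddCommGroup E] [Module (LInfty P) E]

/-- The underlying set of the dual `E'`: the continuous `L^∞`-module homomorphisms `E → L^∞`. -/
abbrev Dual : Type _ := E →L[LInfty P] LInfty P

variable [LInftyNormedModule P E]

/-- The unit ball `U(E) = {x ∈ E | ‖x‖ ≤ 1}`. -/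
def unitBall : Set E := {x | lnorm (P := P) x ≤ 1}

variable {P E}

theorem bddAbove_abs_apply [IsProbabilityMeasure P] (f : Dual P E) :
    BddAbove ((fun x => |f x|) '' unitBall P E) := by
  have hone : ‖(1 : LInfty P)‖ ≤ 1 := by
    rw [Lp.norm_def, eLpNorm_congr_ae LInfty.coeFn_one,
      eLpNorm_const (1 : ℝ) ENNReal.top_ne_zero (IsProbabilityMeasure.ne_zero P)]
    simp
  obtain ⟨δ, hδ, hf⟩ := Metric.continuous_iff.mp f.continuous 0 1 one_pos
  refine ⟨(2 / δ) • (1 : LInfty P), ?_⟩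
  rintro _ ⟨x, hx, rfl⟩
  have hx1 : ‖lnorm (P := P) x‖ ≤ 1 := by
    refine le_trans ?_ hone
    apply norm_le_norm_of_abs_le_abs
    rw [abs_of_nonneg (lnorm_nonneg x)]
    exact le_trans hx (le_abs_self _)
  set y : E := ((δ / 2) • (1 : LInfty P)) • x with hy
  have hyn : ‖y‖ < δ := by
    have h0 : |(δ / 2) • (1 : LInfty P)| = (δ / 2) • (1 : LInfty P) := by
      apply abs_of_nonneg
      rw [← Lp.coeFn_nonneg]
      filter_upwards [Lp.coeFn_smul (δ / 2) (1 : LInfty P), LInfty.coeFn_one (P := P)]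
        with ω h1 h2
      rw [h1, Pi.smul_apply, h2, Pi.zero_apply]
      simpa using (half_pos hδ).le
    rw [norm_eq (P := P), hy, lnorm_smul, h0, LInfty.smul_one_mul, norm_smul, Real.norm_eq_abs,
      abs_of_pos (half_pos hδ)]
    nlinarith
  have hfy : ‖f y‖ ≤ 1 := by
    have := hf y (by simpa [dist_eq_norm] using hyn)
    simpa [dist_eq_norm] using this.le
  have hfx : f x = (2 / δ) • f y := by
    have h1 : f y = (δ / 2) • f x := by
      rw [hy, map_smul, smul_eq_mul, LInfty.smul_one_mul]
    rw [h1, smul_smul]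
    have : 2 / δ * (δ / 2) = 1 := by field_simp
    rw [this, one_smul]
  have hn : ‖f x‖ ≤ 2 / δ := by
    rw [hfx, norm_smul, Real.norm_eq_abs, abs_of_pos (by positivity)]
    exact mul_le_of_le_one_right (by positivity) hfy
  refine (LInfty.abs_le_norm_smul_one (f x)).trans ?_
  rw [← Lp.coeFn_le]
  filter_upwards [Lp.coeFn_smul ‖f x‖ (1 : LInfty P), Lp.coeFn_smul (2 / δ) (1 : LInfty P),
    LInfty.coeFn_one (P := P)] with ω h1 h2 h3
  rw [h1, h2, Pi.smul_apply, Pi.smul_apply, h3]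
  simpa using hn

theorem exists_isLUB_abs_apply [IsProbabilityMeasure P] (f : Dual P E) :
    ∃ t, IsLUB ((fun x => |f x|) '' unitBall P E) t := by
  refine LInfty.exists_isLUB _ ⟨_, 0, ?_, rfl⟩ (bddAbove_abs_apply f)
  have h : lnorm (P := P) (0 : E) = 0 := (lnorm_eq_zero_iff 0).mpr rfl
  rw [unitBall, mem_ofPred, h, ← Lp.coeFn_nonneg]
  filter_upwards [LInfty.coeFn_one (P := P)] with ω h1
  rw [h1]
  exact zero_le_one

/-- The dual `L^∞`-norm `‖f‖' = ⋁ {|f x| : x ∈ E, ‖x‖ ≤ 1}`, a supremum in the almost sure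
order. -/
def dualNorm [IsProbabilityMeasure P] (f : Dual P E) : LInfty P :=
  (exists_isLUB_abs_apply f).choose

theorem isLUB_dualNorm [IsProbabilityMeasure P] (f : Dual P E) :
    IsLUB ((fun x => |f x|) '' unitBall P E) (dualNorm f) :=
  (exists_isLUB_abs_apply f).choose_spec

variable (P E)

/-- The set `A(E)` of all `f ∈ E'` that attain their norm on the unit ball. -/
def normAttaining [IsProbabilityMeasure P] : Set (Dual P E) :=
  {f | ∃ x ∈ unitBall P E, |f x| = dualNorm f}

/-- `E` is subreflexive: `A(E)` is dense in `E'` for the norm `f ↦ ess sup ‖f‖'`. -/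
def IsSubreflexive [IsProbabilityMeasure P] : Prop :=
  ∀ f : Dual P E, ∀ ε : ℝ, 0 < ε → ∃ g ∈ normAttaining P E, ‖dualNorm (f - g)‖ < ε

end LInftyNormedModule

end

/-! This is the Bishop–Phelps argument with values in the ordered ring `L^∞`. For `f` and `ε`,
Ekeland's principle (`exists_forall_sub_le_smul_lnorm`) gives `x₀` in the unit ball with `f x - f x₀
≤ (ε/2)‖x - x₀‖` there. Hence `f ≤ (ε/2)‖·‖` on the cone generated by the vectors `x - x₀`, and the
sandwich theorem (`exists_addMonoidHom_between`) yields an additive `g ≤ (ε/2)‖·‖` with `f ≤ g` on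
that cone. Then `f - g` is maximal on the ball at `x₀`, so it attains its norm, and `‖g‖' ≤ ε/2`.

Since the order is partial, a near-maximal point for `f` must be near-maximal almost everywhere at
once; countable concatenation glues one together (`exists_forall_apply_le`), and completeness turns
a sequence of such points into a maximal one.

Hahn–Banach is run for additive maps of abelian groups, with homogeneity only for natural multiples.
`L^∞`-linearity of `g` is recovered afterwards from its bound (`map_smul_of_le_smul_lnorm`). -/

noncomputable section

/-! ### Hahn–Banach and sandwich theorems for ordered groups -/

/-- Maps between abelian groups that are subadditive and homogeneous for natural multiples. -/
structure IsNatSublinear {G F : Type*} [AddCommGroup G] [AddCommGroup F] [LE F] (q : G → F) :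
    Prop where
  add_le : ∀ x y, q (x + y) ≤ q x + q y
  nsmul_eq : ∀ (n : ℕ) x, q (n • x) = n • q x

namespace IsNatSublinear

variable {G F : Type*} [AddCommGroup G] [AddCommGroup F] [PartialOrder F] [IsOrderedAddMonoid F]

theorem map_zero {G F : Type*} [AddCommGroup G] [AddCommGroup F] [LE F] {q : G → F}
    (hq : IsNatSublinear q) : q 0 = 0 := by
  simpa using hq.nsmul_eq 0 0

theorem neg_map_neg_le {q : G → F} (hq : IsNatSublinear q) (x : G) : -q (-x) ≤ q x := by
  have h := hq.add_le x (-x)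
  rw [add_neg_cancel, hq.map_zero] at h
  exact neg_le_iff_add_nonneg.mpr h

/-- Pointwise infima of compatible families of values are sublinear. -/
theorem of_isGLB {q : G → F} {A : G → Set F} (hA : ∀ x, IsGLB (A x) (q x))
    (hadd : ∀ x y, ∀ a ∈ A x, ∀ b ∈ A y, ∃ c ∈ A (x + y), c ≤ a + b)
    (hsmul : ∀ (n : ℕ) x, ∀ a ∈ A (n • x), ∃ b ∈ A x, n • b ≤ a)
    (hzero : ∃ c ∈ A 0, c ≤ 0) : IsNatSublinear q := by
  have add : ∀ x y, q (x + y) ≤ q x + q y := by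
    intro x y
    rw [← sub_le_iff_le_add]
    refine (hA x).2 fun a ha => ?_
    rw [sub_le_comm]
    refine (hA y).2 fun b hb => ?_
    rw [sub_le_iff_le_add']
    obtain ⟨c, hc, hcab⟩ := hadd x y a ha b hb
    exact ((hA _).1 hc).trans hcab
  refine ⟨add, fun n x => le_antisymm ?_ ?_⟩
  · induction n with
    | zero =>
      obtain ⟨c, hc, h0⟩ := hzero
      simpa using ((hA 0).1 hc).trans h0
    | succ n ih =>
      rw [succ_nsmul, succ_nsmul]
      exact (add _ _).trans (add_le_add_left ih _)
  · refine (hA _).2 fun a ha => ?_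
    obtain ⟨b, hb, hba⟩ := hsmul n x a ha
    exact (nsmul_le_nsmul_right ((hA x).1 hb) n).trans hba

/-- A minimal sublinear map into a Dedekind complete ordered group is additive. -/
theorem map_add_of_minimal (hF : ∀ S : Set F, S.Nonempty → BddBelow S → ∃ t, IsGLB S t)
    {q : G → F} (hq : Minimal (fun q : G → F => IsNatSublinear q) q) (x y : G) :
    q (x + y) = q x + q y := by
  have hs := hq.1
  -- The pointwise infimum `r` of these sets is sublinear, and `k = 0` gives `r ≤ q`. Minimality
  -- forces `q ≤ r`, and `k = 1` then gives `q x + q y ≤ q (x + y)`.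
  set A : G → Set F := fun x => range fun k : ℕ => q (x + k • y) - k • q y with hA
  have hlow : ∀ x, BddBelow (A x) := by
    refine fun x => ⟨-q (-x), ?_⟩
    rintro _ ⟨k, rfl⟩
    have h := hs.add_le (x + k • y) (-x)
    rw [add_neg_cancel_comm, hs.nsmul_eq] at h
    exact neg_le_sub_iff_le_add.mpr h
  choose r hr using fun x => hF (A x) (range_nonempty _) (hlow x)
  have hrs : IsNatSublinear r := by
    refine of_isGLB hr ?_ ?_ ⟨0, ⟨0, by simp [hs.map_zero]⟩, le_rfl⟩
    · rintro u v _ ⟨k, rfl⟩ _ ⟨l, rfl⟩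
      refine ⟨_, ⟨k + l, rfl⟩, ?_⟩
      have h := hs.add_le (u + k • y) (v + l • y)
      have e : u + v + (k + l) • y = u + k • y + (v + l • y) := by rw [add_nsmul]; abel
      have e' : q (u + k • y) - k • q y + (q (v + l • y) - l • q y)
          = q (u + k • y) + q (v + l • y) - (k + l) • q y := by rw [add_nsmul]; abel
      simp only [e, e']
      exact sub_le_sub_right h _
    · rintro n u _ ⟨k, rfl⟩
      refine ⟨_, ⟨k, rfl⟩, ?_⟩
      rcases Nat.eq_zero_or_pos n with rfl | hn
      · simp [hs.nsmul_eq]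
      -- The same `k` serves for `u` and `n • u`: multiplying `u + k • y` by `n = 1 + m` creates `m
      -- * k` surplus copies of `y`, which subadditivity splits off.
      · obtain ⟨m, rfl⟩ := Nat.exists_eq_add_of_le hn
        have h := hs.add_le ((1 + m) • u + k • y) ((m * k) • y)
        have e : (1 + m) • (u + k • y) = (1 + m) • u + k • y + (m * k) • y := by
          simp only [nsmul_add, add_nsmul, one_nsmul, mul_nsmul']; abel
        have e' : (1 + m) • k • q y = k • q y + (m * k) • q y := by
          simp only [add_nsmul, one_nsmul, mul_nsmul']
        simp only [nsmul_sub]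
        rw [← hs.nsmul_eq, e, e', sub_le_iff_le_add]
        refine h.trans (le_of_eq ?_)
        rw [hs.nsmul_eq (m * k) y]
        abel
  have hrq : r ≤ q := fun u => (hr u).1 ⟨0, by simp⟩
  have h1 : q x ≤ q (x + y) - q y :=
    (hq.2 hrs hrq x).trans ((hr x).1 ⟨1, by simp⟩)
  exact le_antisymm (hs.add_le x y) (le_sub_iff_add_le.mp h1)

/-- **Hahn–Banach–Kantorovich**: a sublinear map into a Dedekind complete ordered group dominates
an additive map. -/
theorem exists_addMonoidHom_le (hF : ∀ S : Set F, S.Nonempty → BddBelow S → ∃ t, IsGLB S t)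
    {p : G → F} (hp : IsNatSublinear p) : ∃ g : G →+ F, ∀ x, g x ≤ p x := by
  obtain ⟨m, hpm, hm⟩ := zorn_le_nonempty₀ {q : (G → F)ᵒᵈ | IsNatSublinear (OrderDual.ofDual q)}
      (fun c hc hchain q₀ hq₀ => by
    -- In a chain the smaller of two members bounds both values, so the pointwise infimum stays
    -- subadditive.
    set A : G → Set F := fun x => (fun q : (G → F)ᵒᵈ => OrderDual.ofDual q x) '' c with hA
    have hlow : ∀ x, BddBelow (A x) := by
      refine fun x => ⟨-(OrderDual.ofDual q₀ (-x)), ?_⟩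
      rintro _ ⟨q, hq, rfl⟩
      rcases hchain.total hq hq₀ with h | h
      · exact (neg_map_neg_le (hc hq₀) x).trans (OrderDual.ofDual_le_ofDual.mpr h x)
      · exact (neg_le_neg (OrderDual.ofDual_le_ofDual.mpr h (-x))).trans
          (neg_map_neg_le (hc hq) x)
    choose r hr using fun x => hF (A x) ⟨_, q₀, hq₀, rfl⟩ (hlow x)
    refine ⟨OrderDual.toDual r, ?_, fun q hq => ?_⟩
    · refine of_isGLB hr ?_ ?_ ⟨0, ⟨q₀, hq₀, (hc hq₀).map_zero⟩, le_rfl⟩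
      · rintro x y _ ⟨q, hq, rfl⟩ _ ⟨q', hq', rfl⟩
        rcases hchain.total hq hq' with h | h
        · exact ⟨_, ⟨q', hq', rfl⟩, ((hc hq').add_le x y).trans
            (add_le_add_left (OrderDual.ofDual_le_ofDual.mpr h x) _)⟩
        · exact ⟨_, ⟨q, hq, rfl⟩, ((hc hq).add_le x y).trans
            (add_le_add_right (OrderDual.ofDual_le_ofDual.mpr h y) _)⟩
      · rintro n x _ ⟨q, hq, rfl⟩
        exact ⟨_, ⟨q, hq, rfl⟩, ((hc hq).nsmul_eq n x).ge⟩
    · rw [← OrderDual.ofDual_le_ofDual]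
      exact fun x => (hr x).1 ⟨q, hq, rfl⟩) (OrderDual.toDual p) hp
  have hmin : Minimal (fun q : G → F => IsNatSublinear q) (OrderDual.ofDual m) :=
    ⟨hm.1, fun q hq hqm => hm.2 (y := OrderDual.toDual q) hq hqm⟩
  exact ⟨AddMonoidHom.mk' _ (map_add_of_minimal hF hmin), OrderDual.ofDual_le_ofDual.mpr hpm⟩

/-- **Sandwich theorem**: if the additive map `f` lies below the sublinear map `p` on a divisible
submonoid `C`, then some additive `g ≤ p` lies above `f` on `C`. -/
theorem exists_addMonoidHom_between
    (hF : ∀ S : Set F, S.Nonempty → BddBelow S → ∃ t, IsGLB S t)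
    {p : G → F} (hp : IsNatSublinear p) (f : G →+ F) (C : AddSubmonoid G)
    (hC : ∀ (n : ℕ), n ≠ 0 → ∀ c ∈ C, ∃ c' ∈ C, n • c' = c) (hfp : ∀ c ∈ C, f c ≤ p c) :
    ∃ g : G →+ F, (∀ x, g x ≤ p x) ∧ ∀ c ∈ C, f c ≤ g c := by
  -- Any additive `g` below the infimum `r` works: `c = 0` gives `g ≤ p`, and evaluation at `-c`
  -- gives `-g c ≤ p 0 - f c = -f c`. Divisibility of `C` makes `r` homogeneous.
  set A : G → Set F := fun x => (fun c => p (x + c) - f c) '' C with hA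
  have hlow : ∀ x, BddBelow (A x) := by
    refine fun x => ⟨-p (-x), ?_⟩
    rintro _ ⟨c, hc, rfl⟩
    have h := hp.add_le (x + c) (-x)
    rw [add_neg_cancel_comm] at h
    exact neg_le_sub_iff_le_add.mpr ((hfp c hc).trans h)
  choose r hr using fun x => hF (A x) ⟨_, 0, C.zero_mem, rfl⟩ (hlow x)
  have hrs : IsNatSublinear r := by
    refine of_isGLB hr ?_ ?_ ⟨0, ⟨0, C.zero_mem, by simp [hp.map_zero]⟩, le_rfl⟩
    · rintro x y _ ⟨c, hc, rfl⟩ _ ⟨d, hd, rfl⟩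
      refine ⟨_, ⟨c + d, C.add_mem hc hd, rfl⟩, ?_⟩
      have h := hp.add_le (x + c) (y + d)
      rw [add_add_add_comm] at h
      simp only [map_add, sub_add_sub_comm]
      exact sub_le_sub_right h _
    · rintro n x _ ⟨c, hc, rfl⟩
      rcases eq_or_ne n 0 with rfl | hn
      · exact ⟨_, ⟨0, C.zero_mem, rfl⟩, by simpa using hfp c hc⟩
      · obtain ⟨c', hc', rfl⟩ := hC n hn c hc
        refine ⟨_, ⟨c', hc', rfl⟩, ?_⟩
        simp only [nsmul_sub, ← hp.nsmul_eq, nsmul_add, map_nsmul, le_refl]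
  obtain ⟨g, hg⟩ := exists_addMonoidHom_le hF hrs
  refine ⟨g, fun x => (hg x).trans ((hr x).1 ⟨0, C.zero_mem, by simp⟩), fun c hc => ?_⟩
  have h := (hg (-c)).trans ((hr (-c)).1 ⟨c, hc, rfl⟩)
  simpa [hp.map_zero] using h

end IsNatSublinear

end

/-! ### Automatic linearity and continuity of dominated additive maps -/

noncomputable section

namespace LInfty

variable {Ω : Type*} [MeasurableSpace Ω] {P : Measure Ω}

theorem coeFn_smul_one (r : ℝ) : ⇑(r • (1 : LInfty P)) =ᵐ[P] fun _ => r := by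
  filter_upwards [Lp.coeFn_smul r (1 : LInfty P), coeFn_one (P := P)] with ω h1 h2
  simp [h1, h2]

theorem smul_one_nonneg {r : ℝ} (hr : 0 ≤ r) : 0 ≤ r • (1 : LInfty P) := by
  rw [← Lp.coeFn_nonneg]
  filter_upwards [coeFn_smul_one (P := P) r] with ω h
  simpa [h] using hr

theorem natCast_eq_smul_one (n : ℕ) : (n : LInfty P) = (n : ℝ) • 1 := by
  rw [Nat.cast_smul_eq_nsmul, nsmul_one]

theorem intCast_eq_smul_one (n : ℤ) : (n : LInfty P) = (n : ℝ) • 1 := by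
  rw [Int.cast_smul_eq_zsmul, zsmul_one]

theorem smul_le_smul {r : ℝ} (hr : 0 ≤ r) {f g : LInfty P} (h : f ≤ g) : r • f ≤ r • g := by
  rw [← Lp.coeFn_le] at h ⊢
  filter_upwards [h, Lp.coeFn_smul r f, Lp.coeFn_smul r g] with ω h h1 h2
  simpa [h1, h2] using mul_le_mul_of_nonneg_left h hr

theorem norm_one_le [IsProbabilityMeasure P] : ‖(1 : LInfty P)‖ ≤ 1 := by
  rw [Lp.norm_def, eLpNorm_congr_ae coeFn_one,
    eLpNorm_const (1 : ℝ) ENNReal.top_ne_zero (IsProbabilityMeasure.ne_zero P)]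
  simp

theorem coeFn_ind [IsFiniteMeasure P] {A : Set Ω} (hA : MeasurableSet A) :
    ⇑(ind hA : LInfty P) =ᵐ[P] A.indicator fun _ => 1 :=
  indicatorConstLp_coeFn

theorem exists_isGLB [IsFiniteMeasure P] (S : Set (LInfty P)) (hne : S.Nonempty)
    (hbdd : BddBelow S) : ∃ t, IsGLB S t := by
  obtain ⟨t, ht⟩ := exists_isLUB (-S) hne.neg hbdd.neg
  exact ⟨-t, by simpa using ht.neg⟩

end LInfty

namespace LInftyNormedModule

variable {Ω : Type*} [MeasurableSpace Ω] {P : Measure Ω} {E : Type*} [NormedAddCommGroup E]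
  [Module (LInfty P) E] [LInftyNormedModule P E]

theorem lnorm_zero : lnorm (P := P) (0 : E) = 0 := (lnorm_eq_zero_iff 0).mpr rfl

theorem lnorm_neg (x : E) : lnorm (P := P) (-x) = lnorm x := by
  have h := lnorm_smul (-1 : LInfty P) x
  have h' := lnorm_smul (1 : LInfty P) x
  rw [neg_smul, one_smul, abs_neg] at h
  rw [one_smul] at h'
  rw [h, ← h']

theorem lnorm_smul_of_nonneg {ξ : LInfty P} (hξ : 0 ≤ ξ) (x : E) :
    lnorm (P := P) (ξ • x) = ξ * lnorm x := by
  rw [lnorm_smul, abs_of_nonneg hξ]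

theorem lnorm_nsmul (n : ℕ) (x : E) : lnorm (P := P) (n • x) = n • lnorm x := by
  rw [← Nat.cast_smul_eq_nsmul (LInfty P), lnorm_smul_of_nonneg, nsmul_eq_mul]
  rw [LInfty.natCast_eq_smul_one]
  exact LInfty.smul_one_nonneg n.cast_nonneg

theorem isNatSublinear_smul_lnorm {ε : ℝ} (hε : 0 ≤ ε) :
    IsNatSublinear fun x : E => ε • lnorm (P := P) x where
  add_le x y := by
    rw [← smul_add]
    exact LInfty.smul_le_smul hε (lnorm_add_le x y)
  nsmul_eq n x := by rw [lnorm_nsmul, smul_comm]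

theorem abs_le_smul_lnorm {ε : ℝ} {g : E →+ LInfty P}
    (hg : ∀ x, g x ≤ ε • lnorm x) (x : E) : |g x| ≤ ε • lnorm (P := P) x :=
  abs_le'.mpr ⟨hg x, by simpa [lnorm_neg] using hg (-x)⟩

/-- With `a = ⌊b * s⌋` the factor `|b * s - a|` is at most `1`, so `b * |h - s * k|` stays bounded
as `b` grows. Only countably many inequalities enter, so they may hold almost everywhere
simultaneously. -/
theorem eq_mul_of_forall_abs_le {h k s K : ℝ}
    (H : ∀ (a : ℤ) (b : ℕ), |b * h - a * k| ≤ K * |b * s - a|) : h = s * k := by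
  have key : ∀ b : ℕ, b * |h - s * k| ≤ |K| + |k| := by
    intro b
    have hfl : |b * s - ⌊b * s⌋| ≤ 1 := by
      rw [abs_le]
      constructor <;> linarith [Int.floor_le (b * s), Int.lt_floor_add_one (b * s)]
    have e : b * (h - s * k) = (b * h - ⌊b * s⌋ * k) - (b * s - ⌊b * s⌋) * k := by ring
    calc b * |h - s * k| = |b * (h - s * k)| := by rw [abs_mul, Nat.abs_cast]
      _ ≤ |b * h - ⌊b * s⌋ * k| + |b * s - ⌊b * s⌋| * |k| := by
        rw [e, ← abs_mul]; exact abs_sub _ _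
      _ ≤ |K| + |k| := by
        have h1 := H ⌊b * s⌋ b
        have h2 : K * |b * s - ⌊b * s⌋| ≤ |K| * 1 :=
          mul_le_mul (le_abs_self K) hfl (abs_nonneg _) (abs_nonneg _)
        have h3 := mul_le_mul_of_nonneg_right hfl (abs_nonneg k)
        linarith
  by_contra hne
  have hpos : 0 < |h - s * k| := abs_pos.mpr (sub_ne_zero.mpr hne)
  obtain ⟨b, hb⟩ := exists_nat_gt ((|K| + |k|) / |h - s * k|)
  rw [div_lt_iff₀ hpos] at hb
  exact absurd (key b) (not_le.mpr hb)

/-- An additive map dominated by a multiple of the `L^∞`-norm is `L^∞`-linear. -/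
theorem map_smul_of_le_smul_lnorm {ε : ℝ} {g : E →+ LInfty P}
    (hg : ∀ x, g x ≤ ε • lnorm x) (ξ : LInfty P) (x : E) : g (ξ • x) = ξ * g x := by
  have H : ∀ (a : ℤ) (b : ℕ), ∀ᵐ ω ∂P,
      |b * g (ξ • x) ω - a * g x ω| ≤ ε * lnorm (P := P) x ω * |b * ξ ω - a| := by
    intro a b
    -- Additivity alone evaluates `g` at `(bξ - a)x` for integral `a`, `b`; the bound on `g` there
    -- is the pointwise estimate wanted.
    have e : g (((b : ℝ) • ξ - (a : ℝ) • 1) • x) = (b : ℝ) • g (ξ • x) - (a : ℝ) • g x := by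
      rw [Nat.cast_smul_eq_nsmul, sub_smul, ← LInfty.intCast_eq_smul_one, map_sub,
        Int.cast_smul_eq_zsmul, Int.cast_smul_eq_zsmul, map_zsmul, Nat.cast_smul_eq_nsmul,
        ← map_nsmul, smul_assoc]
    have h := abs_le_smul_lnorm hg (((b : ℝ) • ξ - (a : ℝ) • 1) • x)
    rw [e, lnorm_smul, ← Lp.coeFn_le] at h
    filter_upwards [h, Lp.coeFn_abs ((b : ℝ) • g (ξ • x) - (a : ℝ) • g x),
      Lp.coeFn_sub ((b : ℝ) • g (ξ • x)) ((a : ℝ) • g x),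
      Lp.coeFn_smul (b : ℝ) (g (ξ • x)), Lp.coeFn_smul (a : ℝ) (g x),
      Lp.coeFn_smul ε (|(b : ℝ) • ξ - (a : ℝ) • 1| * lnorm x),
      LInfty.coeFn_mul |(b : ℝ) • ξ - (a : ℝ) • 1| (lnorm x),
      Lp.coeFn_abs ((b : ℝ) • ξ - (a : ℝ) • (1 : LInfty P)),
      Lp.coeFn_sub ((b : ℝ) • ξ) ((a : ℝ) • (1 : LInfty P)), Lp.coeFn_smul (b : ℝ) ξ,
      LInfty.coeFn_smul_one (P := P) a] with ω h h1 h2 h3 h4 h5 h6 h7 h8 h9 h10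
    rw [h1, h2, Pi.sub_apply, h3, h4, h5, Pi.smul_apply, Pi.smul_apply, Pi.smul_apply, h6, h7, h8,
      Pi.sub_apply, h9, h10, Pi.smul_apply] at h
    simp only [smul_eq_mul] at h
    exact h.trans (le_of_eq (by ring))
  apply Lp.ext
  filter_upwards [ae_all_iff.mpr fun a => ae_all_iff.mpr (H a), LInfty.coeFn_mul ξ (g x)]
    with ω h h1
  rw [h1]
  exact eq_mul_of_forall_abs_le h

/-- The continuous `L^∞`-linear map given by an additive map dominated by a multiple of the
`L^∞`-norm. -/
def dualOfLe {ε : ℝ} (hε : 0 ≤ ε) (g : E →+ LInfty P) (hg : ∀ x, g x ≤ ε • lnorm x) :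
    Dual P E where
  toFun := g
  map_add' := map_add g
  map_smul' := map_smul_of_le_smul_lnorm hg
  cont := AddMonoidHomClass.continuous_of_bound g ε fun x => by
    have h := norm_le_norm_of_abs_le_abs ((abs_le_smul_lnorm hg x).trans (le_abs_self _))
    rwa [norm_smul, Real.norm_of_nonneg hε, ← norm_eq] at h

theorem norm_dualNorm_le [IsProbabilityMeasure P] {ε : ℝ} (hε : 0 ≤ ε) {f : Dual P E}
    (hf : ∀ x, |f x| ≤ ε • lnorm x) : ‖dualNorm f‖ ≤ ε := by
  have hlub := isLUB_dualNorm f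
  have h1 : dualNorm f ≤ ε • (1 : LInfty P) := by
    refine hlub.2 ?_
    rintro _ ⟨x, hx, rfl⟩
    exact (hf x).trans (LInfty.smul_le_smul hε hx)
  have h0 : 0 ≤ dualNorm f := by
    refine hlub.1 ⟨0, ?_, by simp⟩
    have := LInfty.smul_one_nonneg (P := P) zero_le_one
    rw [one_smul] at this
    rwa [unitBall, mem_ofPred, lnorm_zero]
  have h2 : ‖dualNorm f‖ ≤ ‖ε • (1 : LInfty P)‖ := by
    apply norm_le_norm_of_abs_le_abs
    rw [abs_of_nonneg h0]
    exact h1.trans (le_abs_self _)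
  rw [norm_smul, Real.norm_of_nonneg hε] at h2
  exact h2.trans (mul_le_of_le_one_right hε LInfty.norm_one_le)

end LInftyNormedModule

end

/-! ### Gluing and almost maximal points -/

noncomputable section

namespace LInfty

variable {Ω : Type*} [MeasurableSpace Ω] {P : Measure Ω} [IsFiniteMeasure P]

theorem ind_nonneg {A : Set Ω} (hA : MeasurableSet A) : 0 ≤ (ind hA : LInfty P) := by
  rw [← Lp.coeFn_nonneg]
  filter_upwards [coeFn_ind (P := P) hA] with ω h
  rw [h]
  exact indicator_nonneg (fun _ _ => zero_le_one) ω

theorem ind_le_one {A : Set Ω} (hA : MeasurableSet A) : (ind hA : LInfty P) ≤ 1 := by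
  rw [← Lp.coeFn_le]
  filter_upwards [coeFn_ind (P := P) hA, coeFn_one (P := P)] with ω h h1
  rw [h, h1]
  exact indicator_le_self' (fun _ _ => zero_le_one) ω

theorem ae_eq_on_of_ind_mul_eq {A : Set Ω} (hA : MeasurableSet A) {f g : LInfty P}
    (h : ind hA * f = ind hA * g) : ∀ᵐ ω ∂P, ω ∈ A → f ω = g ω := by
  filter_upwards [coeFn_mul (ind hA) f, coeFn_mul (ind hA) g, coeFn_ind (P := P) hA]
    with ω h1 h2 h3 hω
  rw [h, h2, h3, indicator_of_mem hω, one_mul, one_mul] at h1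
  exact h1.symm

theorem le_of_ae_le_on {Ω : Type*} [MeasurableSpace Ω] {P : Measure Ω} {A : ℕ → Set Ω}
    (hA : ⋃ n, A n = univ) {f g : LInfty P}
    (h : ∀ n, ∀ᵐ ω ∂P, ω ∈ A n → f ω ≤ g ω) : f ≤ g := by
  rw [← Lp.coeFn_le]
  filter_upwards [ae_all_iff.mpr h] with ω h
  obtain ⟨n, hn⟩ := mem_iUnion.mp (hA ▸ mem_univ ω)
  exact h n hn

end LInfty

namespace LInftyNormedModule

variable {Ω : Type*} [MeasurableSpace Ω] {P : Measure Ω} {E : Type*} [NormedAddCommGroup E]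
  [Module (LInfty P) E]

theorem HasCountableConcatenation.exists_of_cover [IsFiniteMeasure P] {G : Set E}
    (hG : HasCountableConcatenation P G) (f : Dual P E) {g : ℕ → E} (hg : ∀ n, g n ∈ G)
    {D : ℕ → Set Ω} (hD : ∀ n, MeasurableSet (D n)) (hU : ⋃ n, D n = univ) :
    ∃ x ∈ G, ∀ᵐ ω ∂P, ∃ n, ω ∈ D n ∧ f x ω = f (g n) ω := by
  obtain ⟨x, hx, h⟩ := hG g (disjointed D) (fun n => MeasurableSet.disjointed hD n) hg
    (iUnion_disjointed.trans hU) (fun m n hmn => (disjoint_disjointed D hmn).inter_eq)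
  refine ⟨x, hx, ?_⟩
  have h' : ∀ n, ∀ᵐ ω ∂P, ω ∈ disjointed D n → f x ω = f (g n) ω := fun n =>
    LInfty.ae_eq_on_of_ind_mul_eq (MeasurableSet.disjointed hD n) (by
      rw [← smul_eq_mul, ← smul_eq_mul, ← map_smul, ← map_smul, h n])
  filter_upwards [ae_all_iff.mpr h'] with ω hω
  obtain ⟨n, hn⟩ := mem_iUnion.mp ((iUnion_disjointed.trans hU) ▸ mem_univ ω)
  exact ⟨n, disjointed_subset D n hn, hω n hn⟩

/-- On a set with countable concatenation, a bounded `L^∞`-linear functional comes uniformly close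
to its essential supremum. -/
theorem HasCountableConcatenation.exists_forall_apply_le [IsFiniteMeasure P] {G : Set E}
    (hG : HasCountableConcatenation P G) (hne : G.Nonempty) (f : Dual P E)
    (hbdd : BddAbove (f '' G)) {δ : ℝ} (hδ : 0 < δ) :
    ∃ y ∈ G, ∀ z ∈ G, f z ≤ f y + δ • (1 : LInfty P) := by
  obtain ⟨t, ht⟩ := LInfty.exists_isLUB _ (hne.image f) hbdd
  -- `C y` is where `f y` comes within `δ` of the essential supremum. The aim is a `y` whose `C y`
  -- has full measure.
  set C : E → Set Ω := fun y => {ω | t ω - δ < f y ω} with hC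
  have hCm : ∀ y, MeasurableSet (C y) := fun y =>
    measurableSet_lt ((Lp.stronglyMeasurable t).measurable.sub_const δ)
      (Lp.stronglyMeasurable (f y)).measurable
  set I : Set ℝ := (fun y => P.real (C y)) '' G with hI
  have hIb : BddAbove I := ⟨P.real univ, by
    rintro _ ⟨y, -, rfl⟩
    exact measureReal_mono (subset_univ _)⟩
  obtain ⟨u, -, hu, huI⟩ := exists_seq_tendsto_sSup (hne.image _ : I.Nonempty) hIb
  choose y hy hyu using huI
  set V : Set Ω := ⋃ n, C (y n) with hV
  have hVm : MeasurableSet V := MeasurableSet.iUnion fun n => hCm (y n)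
  have hsup : sSup I ≤ P.real V := le_of_tendsto' hu fun n => by
    rw [← hyu]
    exact measureReal_mono (subset_iUnion (fun n => C (y n)) n)
  have hw : ∀ z ∈ G, ∃ w ∈ G, ∀ᵐ ω ∂P, ω ∈ V ∪ C z → ω ∈ C w := by
    intro z hz
    -- Use `y k` on `C (y k)`, and `z` off their union `V`.
    obtain ⟨w, hwG, h⟩ := hG.exists_of_cover f (g := fun n => Nat.casesOn n z y)
      (fun n => by cases n; exacts [hz, hy _]) (D := fun n => Nat.casesOn n Vᶜ fun k => C (y k))
      (fun n => by cases n; exacts [hVm.compl, hCm _]) (by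
        refine eq_univ_of_forall fun ω => ?_
        by_cases hω : ω ∈ V
        · obtain ⟨k, hk⟩ := mem_iUnion.mp hω
          exact mem_iUnion.mpr ⟨k + 1, hk⟩
        · exact mem_iUnion.mpr ⟨0, hω⟩)
    refine ⟨w, hwG, ?_⟩
    filter_upwards [h] with ω ⟨n, hn, hfn⟩ hω
    cases n with
    | zero =>
      have : ω ∈ C z := hω.resolve_left hn
      exact (show t ω - δ < _ from this).trans_eq hfn.symm
    | succ k =>
      have : ω ∈ C (y k) := hn
      exact (show t ω - δ < _ from this).trans_eq hfn.symm
  have hnull : ∀ z ∈ G, ∀ᵐ ω ∂P, ω ∈ C z → ω ∈ V := by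
    intro z hz
    obtain ⟨w, hwG, h⟩ := hw z hz
    have h1 : P.real (V ∪ C z) ≤ P.real (C w) :=
      ENNReal.toReal_mono (measure_ne_top P _) (measure_mono_ae h)
    have h2 : P.real (C w) ≤ sSup I := le_csSup hIb ⟨w, hwG, rfl⟩
    have h3 : P.real (V ∪ C z) = P.real V + P.real (C z \ V) := by
      rw [← union_sdiff_self, measureReal_union disjoint_sdiff_right ((hCm z).diff hVm)]
    have h4 : P.real (C z \ V) = 0 :=
      le_antisymm (by linarith) measureReal_nonneg
    rw [measureReal_eq_zero_iff] at h4
    filter_upwards [measure_eq_zero_iff_ae_notMem.mp h4] with ω hω hz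
    by_contra hn
    exact hω ⟨hz, hn⟩
  have hVfull : ∀ᵐ ω ∂P, ω ∈ V := by
    -- Almost nowhere off `V` does any `f z` exceed `t - δ`, so `t` could be lowered by `δ` there;
    -- being least, it forces `Vᶜ` to be null.
    have hub : t ≤ t - δ • LInfty.ind hVm.compl := by
      refine ht.2 ?_
      rintro _ ⟨z, hz, rfl⟩
      have hzt : f z ≤ t := ht.1 ⟨z, hz, rfl⟩
      rw [← Lp.coeFn_le] at hzt ⊢
      filter_upwards [hzt, hnull z hz, Lp.coeFn_sub t (δ • LInfty.ind hVm.compl),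
        Lp.coeFn_smul δ (LInfty.ind hVm.compl : LInfty P), LInfty.coeFn_ind (P := P) hVm.compl]
        with ω h1 h2 h3 h4 h5
      rw [h3, Pi.sub_apply, h4, Pi.smul_apply, h5]
      by_cases hω : ω ∈ V
      · simpa [hω] using h1
      · have : ¬ t ω - δ < f z ω := fun h => hω (h2 h)
        simpa [hω] using this
    rw [← Lp.coeFn_le] at hub
    filter_upwards [hub, Lp.coeFn_sub t (δ • LInfty.ind hVm.compl),
      Lp.coeFn_smul δ (LInfty.ind hVm.compl : LInfty P), LInfty.coeFn_ind (P := P) hVm.compl]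
      with ω h1 h3 h4 h5
    rw [h3, Pi.sub_apply, h4, Pi.smul_apply, h5] at h1
    by_contra hω
    have : t ω ≤ t ω - δ := by simpa [hω] using h1
    linarith
  obtain ⟨z₀, hz₀⟩ := hne
  obtain ⟨w, hwG, h⟩ := hw z₀ hz₀
  refine ⟨w, hwG, fun z hz => ?_⟩
  have hzt : f z ≤ t := ht.1 ⟨z, hz, rfl⟩
  rw [← Lp.coeFn_le] at hzt ⊢
  filter_upwards [h, hVfull, hzt, Lp.coeFn_add (f w) (δ • (1 : LInfty P)),
    LInfty.coeFn_smul_one (P := P) δ] with ω h1 h2 h3 h4 h5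
  have : t ω - δ < f w ω := h1 (Or.inl h2)
  rw [h4, Pi.add_apply, h5]
  linarith

end LInftyNormedModule

end

/-! ### Ekeland's principle and the support cone -/

noncomputable section

namespace LInftyNormedModule

variable {Ω : Type*} [MeasurableSpace Ω] {P : Measure Ω} {E : Type*} [NormedAddCommGroup E]
  [Module (LInfty P) E] [LInftyNormedModule P E]

theorem continuous_lnorm : Continuous fun x : E => lnorm (P := P) x := by
  refine LipschitzWith.continuous (K := 1) (LipschitzWith.of_dist_le_mul fun x y => ?_)
  rw [dist_eq_norm, dist_eq_norm, NNReal.coe_one, one_mul, norm_eq (P := P) (x - y)]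
  apply norm_le_norm_of_abs_le_abs
  rw [abs_of_nonneg (lnorm_nonneg (P := P) (x - y)), abs_le']
  have h1 := lnorm_add_le (P := P) (x - y) y
  have h2 := lnorm_add_le (P := P) (y - x) x
  rw [sub_add_cancel] at h1 h2
  rw [← neg_sub x y, lnorm_neg] at h2
  exact ⟨sub_le_iff_le_add.mpr h1, by rw [neg_sub]; exact sub_le_iff_le_add.mpr h2⟩

theorem isClosed_unitBall : IsClosed (unitBall P E) :=
  isClosed_le continuous_lnorm continuous_const

theorem zero_mem_unitBall : (0 : E) ∈ unitBall P E := by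
  have := LInfty.smul_one_nonneg (P := P) zero_le_one
  rw [one_smul] at this
  rwa [unitBall, mem_ofPred, lnorm_zero]

theorem neg_mem_unitBall {x : E} (hx : x ∈ unitBall P E) : -x ∈ unitBall P E := by
  rwa [unitBall, mem_ofPred, lnorm_neg]

theorem smul_add_smul_mem_unitBall {x y : E} (hx : x ∈ unitBall P E) (hy : y ∈ unitBall P E)
    {ξ η : LInfty P} (hξ : 0 ≤ ξ) (hη : 0 ≤ η) (h : ξ + η = 1) :
    ξ • x + η • y ∈ unitBall P E := by
  have aux : ∀ {ζ : LInfty P} {z : E}, 0 ≤ ζ → z ∈ unitBall P E → ζ * lnorm z ≤ ζ := by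
    intro ζ z hζ hz
    rw [unitBall, mem_ofPred] at hz
    rw [← Lp.coeFn_le] at hz ⊢
    rw [← Lp.coeFn_nonneg] at hζ
    filter_upwards [hζ, hz, LInfty.coeFn_one (P := P), LInfty.coeFn_mul ζ (lnorm z)]
      with ω h1 h2 h3 h4
    rw [h4]
    exact mul_le_of_le_one_right h1 (h2.trans_eq h3)
  refine (lnorm_add_le _ _).trans ?_
  rw [lnorm_smul_of_nonneg hξ, lnorm_smul_of_nonneg hη, ← h]
  exact add_le_add (aux hξ hx) (aux hη hy)

/-- Convexity with rational weights, cleared of denominators; it makes the support cone additive and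
divisible. -/
theorem exists_mem_unitBall_nsmul {x y : E} (hx : x ∈ unitBall P E) (hy : y ∈ unitBall P E)
    {a b : ℕ} (hab : a + b ≠ 0) : ∃ z ∈ unitBall P E, (a + b) • z = a • x + b • y := by
  have hab' : ((a + b : ℕ) : ℝ) ≠ 0 := Nat.cast_ne_zero.mpr hab
  have key : ∀ (c : ℕ) (w : E),
      (a + b) • (((c / (a + b : ℕ) : ℝ) • (1 : LInfty P)) • w) = c • w := by
    intro c w
    rw [← smul_assoc, ← Nat.cast_smul_eq_nsmul ℝ, smul_smul, mul_div_cancel₀ _ hab',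
      ← LInfty.natCast_eq_smul_one, Nat.cast_smul_eq_nsmul]
  refine ⟨_, smul_add_smul_mem_unitBall hx hy
    (LInfty.smul_one_nonneg (r := a / (a + b : ℕ)) (by positivity))
    (LInfty.smul_one_nonneg (r := b / (a + b : ℕ)) (by positivity)) ?_, ?_⟩
  · rw [← add_smul, ← add_div, ← Nat.cast_add, div_self hab', one_smul]
  · rw [nsmul_add, key, key]

variable (P) in
/-- The points of the unit ball above `x` in the Brøndsted order of slope `ε` given by `f`. -/
def upperPoints (f : Dual P E) (ε : ℝ) (x : E) : Set E :=
  {y | y ∈ unitBall P E ∧ ε • lnorm (P := P) (y - x) ≤ f y - f x}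

theorem self_mem_upperPoints (f : Dual P E) (ε : ℝ) {x : E} (hx : x ∈ unitBall P E) :
    x ∈ upperPoints P f ε x :=
  ⟨hx, by rw [sub_self, sub_self, lnorm_zero, smul_zero]⟩

/-- Transitivity of the order, by the triangle inequality. -/
theorem upperPoints_subset {f : Dual P E} {ε : ℝ} (hε : 0 ≤ ε) {x y : E}
    (hy : y ∈ upperPoints P f ε x) : upperPoints P f ε y ⊆ upperPoints P f ε x := by
  rintro z ⟨hz, h⟩
  refine ⟨hz, ?_⟩
  have h1 := (isNatSublinear_smul_lnorm (P := P) (E := E) hε).add_le (z - y) (y - x)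
  rw [sub_add_sub_cancel] at h1
  have h2 := add_le_add h hy.2
  rw [sub_add_sub_cancel] at h2
  exact h1.trans h2

theorem isClosed_upperPoints (f : Dual P E) (ε : ℝ) (x : E) :
    IsClosed (upperPoints P f ε x) := by
  have h : Continuous fun y : E => ε • lnorm (P := P) (y - x) :=
    (continuous_const_smul (T := LInfty P) ε).comp
      (continuous_lnorm.comp (continuous_id.sub continuous_const))
  have h' : IsClosed {y : E | ε • lnorm (P := P) (y - x) ≤ f y - f x} :=
    isClosed_le h (f.continuous.sub continuous_const)
  exact isClosed_unitBall.inter h'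

/-- The defining inequality is local: on each `A n` both sides take the values they have at `g n`.
-/
theorem hasCountableConcatenation_upperPoints [IsProbabilityMeasure P]
    (hccp : HasCountableConcatenation P (unitBall P E)) (f : Dual P E) (ε : ℝ) (x : E) :
    HasCountableConcatenation P (upperPoints P f ε x) := by
  intro g A hA hg hU hd
  obtain ⟨y, hy, h⟩ := hccp g A hA (fun n => (hg n).1) hU hd
  refine ⟨y, ⟨hy, LInfty.le_of_ae_le_on hU fun n => ?_⟩, h⟩
  have hn : ∀ᵐ ω ∂P, ω ∈ A n → lnorm (P := P) (y - x) ω = lnorm (P := P) (g n - x) ω := by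
    refine LInfty.ae_eq_on_of_ind_mul_eq (hA n) ?_
    rw [← lnorm_smul_of_nonneg (LInfty.ind_nonneg (hA n)), smul_sub, h n, ← smul_sub,
      lnorm_smul_of_nonneg (LInfty.ind_nonneg (hA n))]
  have hf : ∀ᵐ ω ∂P, ω ∈ A n → f y ω = f (g n) ω := by
    refine LInfty.ae_eq_on_of_ind_mul_eq (hA n) ?_
    rw [← smul_eq_mul, ← smul_eq_mul, ← map_smul, ← map_smul, h n]
  filter_upwards [hn, hf, (Lp.coeFn_le _ _).mpr (hg n).2,
    Lp.coeFn_smul ε (lnorm (P := P) (g n - x)), Lp.coeFn_smul ε (lnorm (P := P) (y - x)),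
    Lp.coeFn_sub (f (g n)) (f x), Lp.coeFn_sub (f y) (f x)] with ω h1 h2 h3 h4 h5 h6 h7 hω
  rw [h5, h7, Pi.smul_apply, Pi.sub_apply, h1 hω, h2 hω]
  rwa [h4, h6, Pi.smul_apply, Pi.sub_apply] at h3

theorem bddAbove_apply [IsProbabilityMeasure P] (f : Dual P E) {G : Set E}
    (hG : G ⊆ unitBall P E) : BddAbove (f '' G) := by
  refine ⟨dualNorm f, ?_⟩
  rintro _ ⟨x, hx, rfl⟩
  exact (le_abs_self _).trans ((isLUB_dualNorm f).1 ⟨x, hG hx, rfl⟩)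

/-- The Brøndsted order of the unit ball has a maximal point. -/
theorem exists_upperPoints_subset_singleton [IsProbabilityMeasure P] [CompleteSpace E]
    (hccp : HasCountableConcatenation P (unitBall P E)) (f : Dual P E) {ε : ℝ} (hε : 0 < ε) :
    ∃ x ∈ unitBall P E, upperPoints P f ε x ⊆ {x} := by
  have step : ∀ (n : ℕ) (x : E), x ∈ unitBall P E → ∃ y ∈ upperPoints P f ε x,
      ∀ z ∈ upperPoints P f ε x, f z ≤ f y + ((1 / 2 : ℝ) ^ n) • (1 : LInfty P) := fun n x hx =>
    (hasCountableConcatenation_upperPoints hccp f ε x).exists_forall_apply_le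
      ⟨x, self_mem_upperPoints f ε hx⟩ f (bddAbove_apply f fun _ h => h.1) (by positivity)
  choose! next hnext hmax using step
  set x : ℕ → E := fun n => Nat.rec 0 (fun n y => next n y) n with hx
  have hxU : ∀ n, x n ∈ unitBall P E := by
    intro n
    induction n with
    | zero => exact zero_mem_unitBall
    | succ n ih => exact (hnext n _ ih).1
  have hsucc : ∀ n, x (n + 1) ∈ upperPoints P f ε (x n) := fun n => hnext n _ (hxU n)
  have hmax' : ∀ n, ∀ z ∈ upperPoints P f ε (x n),
      f z ≤ f (x (n + 1)) + ((1 / 2 : ℝ) ^ n) • (1 : LInfty P) := fun n => hmax n _ (hxU n)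
  have hanti : Antitone fun n => upperPoints P f ε (x n) :=
    antitone_nat_of_succ_le fun n => upperPoints_subset hε.le (hsucc n)
  -- The order bounds `ε‖z - x (n + 1)‖` by the gain in `f`, which is at most `2⁻ⁿ` by the choice of
  -- `x (n + 1)`. This makes the sequence Cauchy and also forces any point above its limit to equal
  -- that limit.
  have hclose : ∀ n, ∀ z ∈ upperPoints P f ε (x (n + 1)),
      dist (x (n + 1)) z ≤ ε⁻¹ * (1 / 2) ^ n := by
    intro n z hz
    have h1 : ε • lnorm (P := P) (z - x (n + 1)) ≤ ((1 / 2 : ℝ) ^ n) • (1 : LInfty P) :=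
      hz.2.trans (sub_le_iff_le_add'.mpr (hmax' n z (hanti n.le_succ hz)))
    have h2 : ‖ε • lnorm (P := P) (z - x (n + 1))‖ ≤ ‖((1 / 2 : ℝ) ^ n) • (1 : LInfty P)‖ := by
      apply norm_le_norm_of_abs_le_abs
      refine le_trans (le_of_eq (abs_of_nonneg ?_)) (h1.trans (le_abs_self _))
      simpa using LInfty.smul_le_smul hε.le (lnorm_nonneg (P := P) (z - x (n + 1)))
    rw [norm_smul, norm_smul, ← norm_eq, Real.norm_of_nonneg hε.le,
      Real.norm_of_nonneg (by positivity)] at h2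
    rw [dist_comm, dist_eq_norm, ← div_eq_inv_mul, le_div_iff₀' hε]
    exact h2.trans (mul_le_of_le_one_right (by positivity) LInfty.norm_one_le)
  obtain ⟨x₀, hx₀⟩ := cauchySeq_tendsto_of_complete
    (cauchySeq_of_le_geometric (1 / 2) ε⁻¹ (by norm_num) fun n => hclose n _ (hsucc (n + 1)))
  have hmem : ∀ n, x₀ ∈ upperPoints P f ε (x (n + 1)) := fun n =>
    (isClosed_upperPoints f ε _).mem_of_tendsto hx₀ <| by
      filter_upwards [eventually_ge_atTop n] with m hm
      exact hanti (Nat.succ_le_succ hm) (self_mem_upperPoints f ε (hxU (m + 1)))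
  refine ⟨x₀, (hmem 0).1, fun z hz => ?_⟩
  have hz' : Tendsto (fun n => x (n + 1)) atTop (𝓝 z) := by
    rw [tendsto_iff_dist_tendsto_zero]
    refine squeeze_zero (fun _ => dist_nonneg)
      (fun n => hclose n z (upperPoints_subset hε.le (hmem n) hz)) ?_
    simpa using (tendsto_pow_atTop_nhds_zero_of_lt_one (r := (1 / 2 : ℝ)) (by norm_num)
      (by norm_num)).const_mul ε⁻¹
  exact tendsto_nhds_unique hz' hx₀

/-- **Ekeland's principle** for an `L^∞`-linear functional on the unit ball. -/
theorem exists_forall_sub_le_smul_lnorm [IsProbabilityMeasure P] [CompleteSpace E]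
    (hccp : HasCountableConcatenation P (unitBall P E)) (f : Dual P E) {ε : ℝ} (hε : 0 < ε) :
    ∃ x₀ ∈ unitBall P E, ∀ x ∈ unitBall P E, f x - f x₀ ≤ ε • lnorm (P := P) (x - x₀) := by
  obtain ⟨x₀, hx₀, hmax⟩ := exists_upperPoints_subset_singleton hccp f hε
  refine ⟨x₀, hx₀, fun x hx => ?_⟩
  set u : LInfty P := f x - f x₀ with hu
  set v : LInfty P := ε • lnorm (P := P) (x - x₀) with hv
  -- Move to `x` only where the inequality fails. The resulting `y` lies above `x₀`, so equals it;
  -- thus `u = 0` on this set, impossible with `0 ≤ v < u`.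
  have hA : MeasurableSet {ω | v ω < u ω} :=
    measurableSet_lt (Lp.stronglyMeasurable v).measurable (Lp.stronglyMeasurable u).measurable
  set ξ : LInfty P := LInfty.ind hA with hξ
  have hξ0 : 0 ≤ ξ := LInfty.ind_nonneg hA
  set y : E := ξ • x + (1 - ξ) • x₀ with hy
  have hyx : y - x₀ = ξ • (x - x₀) := by rw [hy, sub_smul, one_smul, smul_sub]; abel
  have hfy : f y - f x₀ = ξ * u := by
    rw [← map_sub, hyx, map_smul, map_sub, smul_eq_mul]
  have hmem : y ∈ upperPoints P f ε x₀ := by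
    refine ⟨smul_add_smul_mem_unitBall hx hx₀ hξ0 (sub_nonneg.mpr (LInfty.ind_le_one hA))
      (add_sub_cancel ξ 1), ?_⟩
    rw [hfy, hyx, lnorm_smul_of_nonneg hξ0, ← LInfty.smul_one_mul, mul_left_comm,
      LInfty.smul_one_mul, ← hv, ← Lp.coeFn_le]
    filter_upwards [LInfty.coeFn_mul ξ v, LInfty.coeFn_mul ξ u, LInfty.coeFn_ind (P := P) hA]
      with ω h1 h2 h3
    rw [h1, h2, h3]
    by_cases hω : v ω < u ω
    · rw [indicator_of_mem (show ω ∈ {ω | v ω < u ω} from hω), one_mul, one_mul]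
      exact hω.le
    · rw [indicator_of_notMem (show ω ∉ {ω | v ω < u ω} from hω), zero_mul, zero_mul]
  have hyeq : y = x₀ := hmax hmem
  have hzero : ξ * u = ξ * 0 := by rw [← hfy, hyeq, sub_self, mul_zero]
  have hv0 : 0 ≤ v := by
    simpa using LInfty.smul_le_smul hε.le (lnorm_nonneg (P := P) (x - x₀))
  rw [← Lp.coeFn_le]
  rw [← Lp.coeFn_nonneg] at hv0
  filter_upwards [LInfty.ae_eq_on_of_ind_mul_eq hA hzero, hv0, Lp.coeFn_zero ℝ ∞ P]
    with ω h1 h2 h3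
  by_contra h
  have h4 : u ω = 0 := (h1 (not_le.mp h)).trans h3
  exact h (h4.trans_le h2)

/-- The cone of natural multiples of `x - x₀` for `x` in the unit ball. -/
def supportCone {x₀ : E} (hx₀ : x₀ ∈ unitBall P E) : AddSubmonoid E where
  carrier := {c | ∃ (n : ℕ), ∃ x ∈ unitBall P E, c = n • (x - x₀)}
  zero_mem' := ⟨0, x₀, hx₀, by simp⟩
  add_mem' := by
    rintro _ _ ⟨n, x, hx, rfl⟩ ⟨m, y, hy, rfl⟩
    by_cases h : n + m = 0
    · obtain ⟨rfl, rfl⟩ := Nat.add_eq_zero_iff.mp h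
      exact ⟨0, x₀, hx₀, by simp⟩
    · obtain ⟨z, hz, e⟩ := exists_mem_unitBall_nsmul hx hy h
      refine ⟨n + m, z, hz, ?_⟩
      rw [nsmul_sub, nsmul_sub, nsmul_sub, e, add_nsmul]
      abel

theorem exists_nsmul_eq_of_mem_supportCone {x₀ : E} (hx₀ : x₀ ∈ unitBall P E) {k : ℕ}
    (hk : k ≠ 0) {c : E} (hc : c ∈ supportCone hx₀) : ∃ c' ∈ supportCone hx₀, k • c' = c := by
  obtain ⟨n, x, hx, rfl⟩ := hc
  obtain ⟨m, rfl⟩ := Nat.exists_eq_add_of_le (Nat.one_le_iff_ne_zero.mpr hk)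
  -- Averaging `x` with `m` copies of `x₀` gives `k • (z - x₀) = x - x₀`.
  obtain ⟨z, hz, e⟩ := exists_mem_unitBall_nsmul hx hx₀ hk
  refine ⟨n • (z - x₀), ⟨n, z, hz, rfl⟩, ?_⟩
  rw [smul_comm, nsmul_sub, e, add_nsmul, one_nsmul, one_nsmul, add_sub_add_right_eq_sub]

end LInftyNormedModule

open LInftyNormedModule in
-- The ball is symmetric, so a maximum of `f` on it is also a maximum of `|f|`.
theorem LInftyNormedModule.mem_normAttaining_of_forall_le {Ω : Type*} [MeasurableSpace Ω]
    {P : Measure Ω} [IsProbabilityMeasure P] {E : Type*} [NormedAddCommGroup E]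
    [Module (LInfty P) E] [LInftyNormedModule P E] {f : Dual P E} {x₀ : E}
    (hx₀ : x₀ ∈ unitBall P E) (h : ∀ x ∈ unitBall P E, f x ≤ f x₀) :
    f ∈ normAttaining P E := by
  suffices hg : IsGreatest ((fun x => |f x|) '' unitBall P E) |f x₀| from
    ⟨x₀, hx₀, hg.isLUB.unique (isLUB_dualNorm f)⟩
  refine ⟨⟨x₀, hx₀, rfl⟩, ?_⟩
  rintro _ ⟨x, hx, rfl⟩
  refine le_trans (abs_le'.mpr ⟨h x hx, ?_⟩) (le_abs_self _)
  rw [← map_neg]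
  exact h _ (neg_mem_unitBall hx)

end

theorem theorem4p6 {Ω : Type*} [MeasurableSpace Ω] (P : Measure Ω) [IsProbabilityMeasure P]
    (E : Type*) [NormedAddCommGroup E] [Module (LInfty P) E] [LInftyNormedModule P E]
    [CompleteSpace E]
    (hccp : LInftyNormedModule.HasCountableConcatenation P (LInftyNormedModule.unitBall P E)) :
    LInftyNormedModule.IsSubreflexive P E := by
  intro f ε hε
  -- Slope `ε / 2` leaves room for the strict inequality at the end.
  obtain ⟨x₀, hx₀, hek⟩ :=
    LInftyNormedModule.exists_forall_sub_le_smul_lnorm hccp f (half_pos hε)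
  obtain ⟨g, hg, hfg⟩ := IsNatSublinear.exists_addMonoidHom_between
    (fun S => LInfty.exists_isGLB S)
    (LInftyNormedModule.isNatSublinear_smul_lnorm (P := P) (E := E) (half_pos hε).le)
    (f : E →+ LInfty P) (LInftyNormedModule.supportCone hx₀)
    (fun n hn c hc => LInftyNormedModule.exists_nsmul_eq_of_mem_supportCone hx₀ hn hc) (by
      rintro _ ⟨n, x, hx, rfl⟩
      rw [map_nsmul, LInftyNormedModule.lnorm_nsmul, smul_comm]
      refine nsmul_le_nsmul_right ?_ n
      simpa using hek x hx)
  set g' := LInftyNormedModule.dualOfLe (half_pos hε).le g hg with hg'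
  refine ⟨f - g', LInftyNormedModule.mem_normAttaining_of_forall_le hx₀ fun x hx => ?_, ?_⟩
  · have h : f (x - x₀) ≤ g (x - x₀) := hfg (x - x₀) ⟨1, x, hx, (one_nsmul _).symm⟩
    rw [map_sub, map_sub] at h
    change f x - g x ≤ f x₀ - g x₀
    exact sub_le_sub_iff.mpr (by
      have := sub_le_sub_iff.mp h
      rwa [add_comm (g x)] at this)
  · have hs : f - (f - g') = g' := sub_sub_cancel f g'
    rw [hs]
    have hle : ‖LInftyNormedModule.dualNorm g'‖ ≤ ε / 2 :=
      LInftyNormedModule.norm_dualNorm_le (half_pos hε).le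
        (LInftyNormedModule.abs_le_smul_lnorm hg)
    exact hle.trans_lt (half_lt_self hε)
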